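/- Let $n$ be a prime, $\zeta\in\mathbb C$ a primitive $n$-th root of unity, and let $T_n(p_1,\dots,p_n)=(p_n,p_1,\dots,p_{n-1})$. Let $\mathbf p^{(1)},\dots,\mathbf p^{(\ell)}$ be distinct elements of $\mathbb N_{-1}\times\mathbb N_0^{\,n-1}$, where $\mathbb N_{-1}=\{-1,0,1,2,\dots\}$, with $\sum_{i=1}^n p^{(k)}_i\ge 1$ for every $k$. Consider the family of polynomial systems $$\dot x_j=F_j(\mathbf x)=x_j\Bigl(\zeta^{j-1}+\sum_{k=1}^{\ell}a_{k,j}\,\mathbf x^{T_n^{j-1}(\mathbf p^{(k)})}\Bigr),\qquad j=1,\dots,n, \tag{nSYS}$$ with parameters $a=(a_{k,j})_{1\le k\le \ell,\,1\le j\le n}\in\mathbb C^{n\ell}$. The system with parameters $a$ is called $\zeta$-reversible if there are $\alpha_1,\dots,\alpha_n\in\mathbb C$ with $\alpha_1\cdots\alpha_n=1$ such that $A F(\mathbf x)=\zeta F(A\mathbf x)$ for all $\mathbf x\in\mathbb C^n$, where $A\mathbf x=(\alpha_1x_2,\alpha_2x_3,\dots,\alpha_{n-1}x_n,\alpha_nx_1)$.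 For $\nu=(\nu_{k,j})\in\mathbb N_0^{n\ell}$ put $[\nu]=\prod_{k,j}a_{k,j}^{\nu_{k,j}}\in\mathbb C[a]$, $|\nu|=\sum_{k,j}\nu_{k,j}$, $L(\nu)=\sum_{k,j}\nu_{k,j}\,T_n^{j-1}(\mathbf p^{(k)})\in\mathbb Z^n$, and let $\hat\nu$ be given by $\hat\nu_{k,j}=\nu_{k,j-1}$ for $2\le j\le n$ and $\hat\nu_{k,1}=\nu_{k,n}$. Let $$\mathcal M^{(n)}=\{\nu\in\mathbb N_0^{n\ell}: L(\nu)=(K,\dots,K)\text{ for some }K\in\mathbb N_0\},\qquad I_R^{(n)}=\bigl\langle \zeta^{|\nu|}[\nu]-[\hat\nu] : \nu\in\mathcal M^{(n)}\bigr\rangle\subseteq\mathbb C[a],$$ let $\mathsf a=\prod_{k,j}a_{k,j}$, and let $I_\zeta=I^{(\zeta)}\cap\mathbb C[a]$, where $I^{(\zeta)}$ is the ideal of $\mathbb C[\alpha_1^{\pm1},\dots,\alpha_n^{\pm1},a]$ generated by $1-\alpha_1\cdots\alpha_n$ and all $\zeta\, a_{k,j}\,\alpha^{T_n^{j-1}(\mathbf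 p^{(k)})}-a_{k,j+1}$, $1\le k\le\ell$, $1\le j\le n$ (with $a_{k,n+1}:=a_{k,1}$). Then $$I_R^{(n)}:\mathsf a^\infty=I_\zeta,$$ where $I:\mathsf a^\infty=\{g\in\mathbb C[a]:\mathsf a^m g\in I\text{ for some }m\ge 0\}$. Moreover, the variety of $I_\zeta$ in $\mathbb C^{n\ell}$ is the Zariski closure of the set of parameters of $\zeta$-reversible systems. -/

import Mathlib

noncomputable section

namespace ZetaReversible

open MvPolynomial

variable {n ℓ : ℕ}

/-- The cyclic shift `T_n (p₁, p₂, …, pₙ) = (pₙ, p₁, …, pₙ₋₁)` of `n`-tuples. Tuples are indexed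
by `Fin n` (entries are counted from `0`); `finRotate n` is
`j ↦ j + 1` modulo `n`. -/
def cycShift {α : Type*} (p : Fin n → α) : Fin n → α :=
  fun i => p ((finRotate n).symm i)

/-- The index set of the `n ℓ` parameters: `(k, j)` stands for the coefficient of
`x_j · x ^ (T_n^j p_k)` in the `j`-th equation (with `j` counted from `0`). -/
abbrev Param (n ℓ : ℕ) : Type := Fin ℓ × Fin n

/-- The polynomial ring `ℂ[a]` in the parameters of the family. -/
abbrev ParamRing (n ℓ : ℕ) : Type := MvPolynomial (Param n ℓ) ℂ

/-- The exponent `T_n^j p_k ∈ ℤⁿ` that belongs to the parameter `(k, j)`. -/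
def expo (p : Fin ℓ → Fin n → ℤ) (kj : Param n ℓ) : Fin n → ℤ :=
  cycShift^[(kj.2 : ℕ)] (p kj.1)

/-! ### The family of systems and its `ζ`-reversible members -/

/-- The right-hand side of the system with parameter values `a`: its `j`-th component is
`x_j (ζ^j + ∑_k a_{k,j} x^(T_n^j p_k))`. The exponent of `x_j` in `x_j x^(T_n^j p_k)` is the first
entry of `p_k` plus one, so all exponents are nonnegative for admissible `p`, and the products are
written as honest monomials. -/
def vectorField (p : Fin ℓ → Fin n → ℤ) (ζ : ℂ) (a : Param n ℓ → ℂ) (x : Fin n → ℂ) :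
    Fin n → ℂ :=
  fun j => ζ ^ (j : ℕ) * x j +
    ∑ k, a (k, j) * ∏ i, x i ^ (expo p (k, j) i + if i = j then 1 else 0).toNat

/-- The matrix with entries `α₁, …, αₙ₋₁` just above the diagonal, `αₙ` in the lower left corner
and zeros elsewhere. -/
def cycMatrix (α : Fin n → ℂ) : Matrix (Fin n) (Fin n) ℂ :=
  Matrix.of fun i j => if j = finRotate n i then α i else 0

/-- The system with parameter values `a` is `ζ`-reversible: `A F(x) = ζ F(A x)` for some matrix `A`
as above with `α₁ α₂ ⋯ αₙ = 1`. -/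
def IsZetaReversible (p : Fin ℓ → Fin n → ℤ) (ζ : ℂ) (a : Param n ℓ → ℂ) : Prop :=
  ∃ α : Fin n → ℂ, ∏ i, α i = 1 ∧ ∀ x : Fin n → ℂ,
    (cycMatrix α).mulVec (vectorField p ζ a x) =
      ζ • vectorField p ζ a ((cycMatrix α).mulVec x)

/-- The Zariski closure of a subset of the affine space `ℂ^σ`: the intersection of all algebraic
sets that contain it. -/
def zariskiClosure {σ : Type*} (S : Set (σ → ℂ)) : Set (σ → ℂ) :=
  ⋂ (J : Ideal (MvPolynomial σ ℂ)) (_ : S ⊆ zeroLocus ℂ J), zeroLocus ℂ J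

/-! ### The elimination ideal -/

/-- The ring `ℂ[α₁^±, …, αₙ^±, a]`, as Laurent polynomials in `α` with coefficients in `ℂ[a]`. -/
abbrev LaurentRing (n ℓ : ℕ) : Type := AddMonoidAlgebra (ParamRing n ℓ) (Fin n → ℤ)

/-- The Laurent monomial `α^q`. -/
def alphaPow (ℓ : ℕ) (q : Fin n → ℤ) : LaurentRing n ℓ := AddMonoidAlgebra.single q 1

/-- The inclusion `ℂ[a] → ℂ[α^±, a]`. -/
def inclusion (n ℓ : ℕ) : ParamRing n ℓ →+* LaurentRing n ℓ :=
  AddMonoidAlgebra.singleZeroRingHom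

/-- The ideal of `ℂ[α^±, a]` generated by `1 - α₁ ⋯ αₙ` and by all
`ζ a_{k,j} α^(T_n^j p_k) - a_{k,j+1}`, with `j + 1` taken modulo `n`. -/
def reversibilityIdeal (p : Fin ℓ → Fin n → ℤ) (ζ : ℂ) : Ideal (LaurentRing n ℓ) :=
  Ideal.span ({1 - alphaPow ℓ (fun _ => 1)} ∪
    Set.range fun kj : Param n ℓ =>
      inclusion n ℓ (C ζ * X kj) * alphaPow ℓ (expo p kj) -
        inclusion n ℓ (X (kj.1, finRotate n kj.2)))

/-- The elimination ideal `I_ζ`: the intersection of the previous ideal with `ℂ[a]`. -/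
def elimIdeal (p : Fin ℓ → Fin n → ℤ) (ζ : ℂ) : Ideal (ParamRing n ℓ) :=
  (reversibilityIdeal p ζ).comap (inclusion n ℓ)

/-! ### The ideal `I_R` -/

/-- The monomial `[ν] = ∏ a_{k,j}^ν_{k,j}`. -/
def mono (ν : Param n ℓ → ℕ) : ParamRing n ℓ := ∏ kj, X kj ^ ν kj

/-- `L(ν) = ∑_{k,j} ν_{k,j} T_n^j p_k ∈ ℤⁿ`. -/
def L (p : Fin ℓ → Fin n → ℤ) (ν : Param n ℓ → ℕ) : Fin n → ℤ :=
  fun i => ∑ kj, expo p kj i * (ν kj : ℤ)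

/-- The monoid `M` of all `ν` with `L(ν) = (K, K, …, K)` for some `K ∈ ℕ`. -/
def invMonoid (p : Fin ℓ → Fin n → ℤ) : Set (Param n ℓ → ℕ) :=
  {ν | ∃ K : ℕ, ∀ i, L p ν i = K}

/-- `ν̂`: each block `(ν_{k,1}, …, ν_{k,n})` is replaced by `(ν_{k,n}, ν_{k,1}, …, ν_{k,n-1})`. -/
def hat (ν : Param n ℓ → ℕ) : Param n ℓ → ℕ :=
  fun kj => cycShift (fun j => ν (kj.1, j)) kj.2

/-- `I_R`, generated by all `ζ^|ν| [ν] - [ν̂]` with `ν ∈ M`. -/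
def sibirskyR (p : Fin ℓ → Fin n → ℤ) (ζ : ℂ) : Ideal (ParamRing n ℓ) :=
  Ideal.span {f | ∃ ν ∈ invMonoid p, f = C (ζ ^ ∑ kj, ν kj) * mono ν - mono (hat ν)}

/-- The product of all parameters. -/
def paramProd (n ℓ : ℕ) : ParamRing n ℓ := ∏ kj, X kj

/-- The saturation `I : f^∞ = {g | f^m g ∈ I for some m}`. -/
def saturation {R : Type*} [CommRing R] (I : Ideal R) (f : R) : Ideal R where
  carrier := {g | ∃ m : ℕ, f ^ m * g ∈ I}
  zero_mem' := ⟨0, by simp⟩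
  add_mem' := by
    rintro a b ⟨m, hm⟩ ⟨k, hk⟩
    refine ⟨m + k, ?_⟩
    have h : f ^ (m + k) * (a + b) = f ^ k * (f ^ m * a) + f ^ m * (f ^ k * b) := by ring
    rw [h]
    exact I.add_mem (I.mul_mem_left _ hm) (I.mul_mem_left _ hk)
  smul_mem' := by
    rintro c a ⟨m, hm⟩
    refine ⟨m, ?_⟩
    have h : f ^ m * (c • a) = c * (f ^ m * a) := by simp only [smul_eq_mul]; ring
    rw [h]
    exact I.mul_mem_left _ hm

end ZetaReversible

end

/-! Comparing coefficients of the distinct monomials, `ζ`-reversibility means `a_{k,j+1} = ζ a_{k,j}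
α^(T_n^j p_k)` for some `α` in the torus `α₁ ⋯ αₙ = 1` (`IsAdmissible.isZetaReversible_iff`). Such
twisted points are determined by `α` and `y_k = a_{k,1}`, and at them every monomial `[u]` equals a
power of `ζ` times a character of `(y, α)` (`IsTwisted.aeval_mono_eq`).

Both ideals turn out to be the vanishing ideal of the twisted points with all `y_k ≠ 0`. Both vanish
there; for the saturation this uses that no coordinate is zero. Conversely, by Dedekind's
independence of characters, a polynomial vanishing at these points is a combination of binomials
`ζ^w(v) [u] - ζ^w(u) [v]` whose two characters coincide (`mem_of_forall_eval_eq_zero`). These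
binomials lie in `I_ζ` by the monomial formula in the quotient of the Laurent ring
(`binomial_mem_elimIdeal`), and in the saturation because a monomial multiple of each is a multiple
of one generator of `I_R` (`binomial_mem_saturation`).

The statement on varieties follows: `I_ζ` vanishes at all reversible parameters and contains every
polynomial vanishing there. -/

namespace ZetaReversible

open MvPolynomial

/-! ### Polynomials vanishing on a family of points given by characters -/

/-- If the monomials, evaluated along a family of points indexed by a monoid, are nonzero multiples
of characters, then a polynomial that vanishes on the family lies in every ideal containing the
binomials attached to coinciding characters. -/
lemma mem_of_forall_eval_eq_zero {σ D K : Type*} [Field K] [Monoid D]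
    (J : Ideal (MvPolynomial σ K)) (φ : (σ →₀ ℕ) → (D →* K)) (c : (σ →₀ ℕ) → K)
    (hc : ∀ u, c u ≠ 0) (pt : D → σ → K)
    (hpt : ∀ d u, eval (pt d) (monomial u 1) = c u * φ u d)
    (hJ : ∀ u v, φ u = φ v → C (c v) * monomial u 1 - C (c u) * monomial v 1 ∈ J)
    (f : MvPolynomial σ K) (hf : ∀ d, eval (pt d) f = 0) : f ∈ J := by
  classical
  -- One representative monomial per character; the arbitrary values of `invFun` off the range of
  -- `φ` play no role, since `Θ` only meets characters in the range.
  let ρ : (D →* K) → (σ →₀ ℕ) := Function.invFun φ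
  have hρ : ∀ u, φ (ρ (φ u)) = φ u := fun u => Function.invFun_eq ⟨u, rfl⟩
  let Θ : MvPolynomial σ K →ₗ[K] ((D →* K) →₀ K) :=
    (basisMonomials σ K).constr K fun u => Finsupp.single (φ u) (c u)
  have hΘ : ∀ u, Θ (monomial u 1) = Finsupp.single (φ u) (c u) := fun u => by
    have := (basisMonomials σ K).constr_basis K (fun u => Finsupp.single (φ u) (c u)) u
    simpa [Θ] using this
  -- Both reduction modulo `J` and evaluation at the points factor through `Θ`. The second factor
  -- `T` is injective by independence of characters, so vanishing at the points forces `Θ f = 0`,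
  -- hence `f ∈ J`.
  let Ψ : ((D →* K) →₀ K) →ₗ[K] (MvPolynomial σ K ⧸ J) :=
    Finsupp.linearCombination K fun χ =>
      Ideal.Quotient.mkₐ K J (C (c (ρ χ))⁻¹ * monomial (ρ χ) 1)
  have h1 : Ψ ∘ₗ Θ = (Ideal.Quotient.mkₐ K J).toLinearMap := by
    refine (basisMonomials σ K).ext fun u => ?_
    simp only [coe_basisMonomials, LinearMap.comp_apply, hΘ, Ψ, Finsupp.linearCombination_single,
      AlgHom.toLinearMap_apply, ← map_smul]
    refine (Ideal.Quotient.eq.2 ?_)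
    have h := J.mul_mem_left (C (c (ρ (φ u)))⁻¹) (hJ _ _ (hρ u))
    convert h using 1
    have h2 : (C (c (ρ (φ u)))⁻¹ * C (c (ρ (φ u))) : MvPolynomial σ K) = 1 := by
      rw [← C_mul, inv_mul_cancel₀ (hc _), C_1]
    rw [smul_eq_C_mul, mul_sub]
    linear_combination (monomial u 1) * h2
  let T : ((D →* K) →₀ K) →ₗ[K] (D → K) :=
    Finsupp.linearCombination K fun χ : D →* K => (χ : D → K)
  have h2 : T ∘ₗ Θ = LinearMap.pi fun d => (aeval (pt d)).toLinearMap := by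
    refine (basisMonomials σ K).ext fun u => ?_
    funext d
    simp only [coe_basisMonomials, LinearMap.comp_apply, hΘ, T, Finsupp.linearCombination_single,
      LinearMap.pi_apply, AlgHom.toLinearMap_apply, Pi.smul_apply, smul_eq_mul]
    exact (hpt d u).symm
  have h3 : T (Θ f) = 0 := by
    rw [← LinearMap.comp_apply, h2]
    funext d
    simpa using hf d
  have h4 : Θ f = 0 := (linearIndependent_iff.1 (linearIndependent_monoidHom D K)) _ h3
  have h5 := LinearMap.congr_fun h1 f
  rw [LinearMap.comp_apply, h4, map_zero] at h5
  exact Ideal.Quotient.eq_zero_iff_mem.1 h5.symm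

/-! ### Cyclic shifts -/

variable {n ℓ : ℕ}

lemma cycShift_apply [NeZero n] {α : Type*} (q : Fin n → α) (i : Fin n) :
    cycShift q i = q (i - 1) := by
  have : (finRotate n).symm i = i - 1 := by
    rw [Equiv.symm_apply_eq, finRotate_apply, sub_add_cancel]
  rw [cycShift, this]

lemma cycShift_iterate_apply [NeZero n] {α : Type*} (q : Fin n → α) (m : ℕ) (i : Fin n) :
    cycShift^[m] q i = q (i - m • (1 : Fin n)) := by
  induction m generalizing i with
  | zero => simp
  | succ m ih =>
    rw [Function.iterate_succ_apply', cycShift_apply, ih, succ_nsmul]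
    congr 1
    abel

lemma val_nsmul_one [NeZero n] (j : Fin n) : (j : ℕ) • (1 : Fin n) = j := by
  obtain ⟨m, rfl⟩ := Nat.exists_eq_succ_of_ne_zero (NeZero.ne n)
  open scoped Fin.CommRing in
  rw [nsmul_one]
  exact Fin.cast_val_eq_self j

lemma expo_apply [NeZero n] (p : Fin ℓ → Fin n → ℤ) (kj : Param n ℓ) (i : Fin n) :
    expo p kj i = p kj.1 (i - kj.2) := by
  rw [expo, cycShift_iterate_apply, val_nsmul_one]

lemma expo_finRotate [NeZero n] (p : Fin ℓ → Fin n → ℤ) (k : Fin ℓ) (j i : Fin n) :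
    expo p (k, finRotate n j) (finRotate n i) = expo p (k, j) i := by
  simp [expo_apply]

lemma sum_expo [NeZero n] (p : Fin ℓ → Fin n → ℤ) (kj : Param n ℓ) :
    ∑ i, expo p kj i = ∑ i, p kj.1 i := by
  simp only [expo_apply]
  exact Equiv.sum_comp (Equiv.subRight kj.2) (p kj.1)

/-- The sum of the first `m` shifts of `p_k`. -/
def partialExpo (p : Fin ℓ → Fin n → ℤ) (k : Fin ℓ) (m : ℕ) : Fin n → ℤ :=
  ∑ t ∈ Finset.range m, cycShift^[t] (p k)

lemma partialExpo_succ (p : Fin ℓ → Fin n → ℤ) (k : Fin ℓ) (j : Fin n) :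
    partialExpo p k (j + 1) = partialExpo p k j + expo p (k, j) :=
  Finset.sum_range_succ _ _

/-- Over a full cycle each entry of `p_k` visits each position once. This lets the twisted relations
close up. -/
lemma partialExpo_self [NeZero n] (p : Fin ℓ → Fin n → ℤ) (k : Fin ℓ) :
    partialExpo p k n = (∑ i, p k i) • fun _ => 1 := by
  funext i
  simp only [partialExpo, Finset.sum_apply, Pi.smul_apply, smul_eq_mul, mul_one]
  rw [Finset.sum_range]
  simp only [cycShift_iterate_apply, val_nsmul_one]
  exact Equiv.sum_comp (Equiv.subLeft i) (p k)

lemma finRotate_cases [NeZero n] (j : Fin n) :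
    ((finRotate n j : Fin n) : ℕ) = j + 1 ∨ (j : ℕ) + 1 = n ∧ ((finRotate n j : Fin n) : ℕ) = 0 := by
  obtain ⟨m, rfl⟩ := Nat.exists_eq_succ_of_ne_zero (NeZero.ne n)
  by_cases h : (j : ℕ) < m
  · exact Or.inl (coe_finRotate_of_ne_last (Fin.ne_of_val_ne (by simpa using h.ne)))
  · have h1 : (j : ℕ) = m := by omega
    have h2 : j = Fin.last m := Fin.ext h1
    exact Or.inr ⟨by omega, by rw [h2, finRotate_last]; rfl⟩

/-! ### Twisted points -/

/-- The relations `a_{k,j+1} = ζ a_{k,j} χ(T_n^j p_k)` for a family `a` in a `ℂ`-algebra and a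
multiplicative character `χ` of `ℤⁿ`. -/
def IsTwisted {R : Type*} [CommRing R] [Algebra ℂ R] (p : Fin ℓ → Fin n → ℤ) (ζ : ℂ)
    (χ : Multiplicative (Fin n → ℤ) →* R) (a : Param n ℓ → R) : Prop :=
  ∀ kj : Param n ℓ, a (kj.1, finRotate n kj.2) =
    algebraMap ℂ R ζ * a kj * χ (Multiplicative.ofAdd (expo p kj))

/-- The exponent of `ζ` in the value of `[ν]` at a twisted point. -/
def weight (ν : Param n ℓ → ℕ) : ℕ := ∑ kj, (kj.2 : ℕ) * ν kj

/-- The sum of the `k`-th block of `ν`. -/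
def blockSum (ν : Param n ℓ → ℕ) (k : Fin ℓ) : ℕ := ∑ j, ν (k, j)

/-- The argument of the character in the value of `[ν]` at a twisted point. -/
def cumExpo (p : Fin ℓ → Fin n → ℤ) (ν : Param n ℓ → ℕ) : Fin n → ℤ :=
  ∑ kj, ν kj • partialExpo p kj.1 kj.2

lemma monomial_one_eq_mono (u : Param n ℓ →₀ ℕ) : monomial u (1 : ℂ) = mono u := by
  rw [monomial_eq, C_1, one_mul, mono, Finsupp.prod_fintype _ _ fun _ => pow_zero _]

lemma mono_add (u v : Param n ℓ → ℕ) : mono (u + v) = mono u * mono v := by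
  simp [mono, pow_add, Finset.prod_mul_distrib]

lemma L_eq_sum (p : Fin ℓ → Fin n → ℤ) (ν : Param n ℓ → ℕ) : L p ν = ∑ kj, ν kj • expo p kj := by
  funext i
  simp [L, mul_comm]

lemma map_ofAdd_sum_smul {R : Type*} [CommRing R] (χ : Multiplicative (Fin n → ℤ) →* R)
    (ν : Param n ℓ → ℕ) (e : Param n ℓ → Fin n → ℤ) :
    χ (Multiplicative.ofAdd (∑ kj, ν kj • e kj)) =
      ∏ kj, χ (Multiplicative.ofAdd (e kj)) ^ ν kj := by
  simp only [ofAdd_sum, ofAdd_nsmul, map_prod, map_pow]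

section

variable {R : Type*} [CommRing R] [Algebra ℂ R] {p : Fin ℓ → Fin n → ℤ} {ζ : ℂ}
  {χ : Multiplicative (Fin n → ℤ) →* R} {a : Param n ℓ → R}

lemma aeval_mono (a : Param n ℓ → R) (ν : Param n ℓ → ℕ) :
    aeval a (mono ν) = ∏ kj, a kj ^ ν kj := by
  simp [mono]

lemma IsTwisted.apply_eq [NeZero n] (h : IsTwisted p ζ χ a) (k : Fin ℓ) (j : Fin n) :
    a (k, j) = algebraMap ℂ R ζ ^ (j : ℕ) * a (k, 0) *
      χ (Multiplicative.ofAdd (partialExpo p k j)) := by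
  obtain ⟨m, hm⟩ := j
  induction m with
  | zero => simp [partialExpo]
  | succ m ih =>
    have hm' : m < n := by omega
    have hr : finRotate n ⟨m, hm'⟩ = ⟨m + 1, hm⟩ := by
      rcases finRotate_cases ⟨m, hm'⟩ with h | ⟨h, -⟩
      · exact Fin.ext h
      · simp only at h; omega
    have h1 := h (k, ⟨m, hm'⟩)
    simp only [hr] at h1
    rw [h1, ih hm']
    have h2 := partialExpo_succ p k ⟨m, hm'⟩
    simp only at h2 ⊢
    rw [h2, ofAdd_add, map_mul, pow_succ]
    ring

lemma IsTwisted.aeval_mono_eq [NeZero n] (h : IsTwisted p ζ χ a) (ν : Param n ℓ → ℕ) :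
    aeval a (mono ν) = algebraMap ℂ R (ζ ^ weight ν) * (∏ k, a (k, 0) ^ blockSum ν k) *
      χ (Multiplicative.ofAdd (cumExpo p ν)) := by
  rw [aeval_mono, cumExpo, map_ofAdd_sum_smul, weight, map_pow, ← Finset.prod_pow_eq_pow_sum]
  have h1 : ∏ k, a (k, 0) ^ blockSum ν k = ∏ kj : Param n ℓ, a (kj.1, 0) ^ ν kj := by
    rw [Fintype.prod_prod_type]
    exact Finset.prod_congr rfl fun k _ => (Finset.prod_pow_eq_pow_sum _ _ _).symm
  rw [h1, ← Finset.prod_mul_distrib, ← Finset.prod_mul_distrib]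
  refine Finset.prod_congr rfl fun kj _ => ?_
  rw [show a kj = a (kj.1, kj.2) from rfl, h.apply_eq kj.1 kj.2, mul_pow, mul_pow, pow_mul]

lemma prod_pow_hat {S : Type*} [CommRing S] (a : Param n ℓ → S) (ν : Param n ℓ → ℕ) :
    ∏ kj, a kj ^ hat ν kj = ∏ kj : Param n ℓ, a (kj.1, finRotate n kj.2) ^ ν kj := by
  rw [← Equiv.prod_comp ((Equiv.refl (Fin ℓ)).prodCongr (finRotate n))]
  refine Finset.prod_congr rfl fun kj _ => ?_
  change a (kj.1, finRotate n kj.2) ^ ν (kj.1, (finRotate n).symm (finRotate n kj.2)) = _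
  rw [Equiv.symm_apply_apply]

/-- The product of the twisted relations with multiplicities `ν`. The generator of `I_R` attached to
`ν` thus vanishes as soon as `χ` is trivial on `L(ν)`. -/
lemma IsTwisted.aeval_mono_hat (h : IsTwisted p ζ χ a) (ν : Param n ℓ → ℕ) :
    aeval a (mono (hat ν)) = algebraMap ℂ R (ζ ^ ∑ kj, ν kj) * aeval a (mono ν) *
      χ (Multiplicative.ofAdd (L p ν)) := by
  rw [aeval_mono, aeval_mono, prod_pow_hat, L_eq_sum, map_ofAdd_sum_smul, map_pow,
    ← Finset.prod_pow_eq_pow_sum, ← Finset.prod_mul_distrib, ← Finset.prod_mul_distrib]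
  refine Finset.prod_congr rfl fun kj _ => ?_
  rw [h kj, mul_pow, mul_pow]

/-- The twisted point with prescribed values `y_k` of the coordinates `a_{k,1}`. -/
def twistedPoint (p : Fin ℓ → Fin n → ℤ) (ζ : ℂ) (χ : Multiplicative (Fin n → ℤ) →* R)
    (y : Fin ℓ → R) : Param n ℓ → R := fun kj =>
  algebraMap ℂ R ζ ^ (kj.2 : ℕ) * y kj.1 * χ (Multiplicative.ofAdd (partialExpo p kj.1 kj.2))

/-- Only the relation from the last index back to the first is not built in; it needs `ζ ^ n = 1`
and `χ` trivial on `(1, …, 1)`. Nonnegative sums allow natural powers, as `χ` takes values in a mere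
monoid. -/
lemma isTwisted_twistedPoint [NeZero n] (hζ : ζ ^ n = 1)
    (hχ : χ (Multiplicative.ofAdd fun _ => 1) = 1) (hp : ∀ k, 0 ≤ ∑ i, p k i) (y : Fin ℓ → R) :
    IsTwisted p ζ χ (twistedPoint p ζ χ y) := by
  rintro ⟨k, j⟩
  have h1 := congrArg (fun q => χ (Multiplicative.ofAdd q)) (partialExpo_succ p k j)
  simp only [ofAdd_add, map_mul] at h1
  rcases finRotate_cases j with h | ⟨hj, h⟩
  · simp only [twistedPoint, h, h1]
    ring
  · rw [hj, partialExpo_self] at h1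
    obtain ⟨s, hs⟩ := Int.eq_ofNat_of_zero_le (hp k)
    rw [hs, natCast_zsmul, ofAdd_nsmul, map_pow, hχ, one_pow] at h1
    have h2 : algebraMap ℂ R ζ * algebraMap ℂ R ζ ^ (j : ℕ) = 1 := by
      rw [← pow_succ', hj, ← map_pow, hζ, map_one]
    simp only [twistedPoint, h, pow_zero, partialExpo, Finset.range_zero, Finset.sum_empty,
      ofAdd_zero, map_one] at h1 ⊢
    linear_combination (-y k) * h2 + (algebraMap ℂ R ζ * algebraMap ℂ R ζ ^ (j : ℕ) * y k) * h1

end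

/-! ### Characters of the torus -/

/-- The evaluation `q ↦ α^q` of Laurent monomials at a point of the torus. -/
def torusChar (α : Fin n → ℂˣ) : Multiplicative (Fin n → ℤ) →* ℂ :=
  (Units.coeHom ℂ).comp
    { toFun := fun q => ∏ i, α i ^ (q.toAdd i)
      map_one' := by simp
      map_mul' := fun q r => by simp [zpow_add, Finset.prod_mul_distrib] }

lemma torusChar_ofAdd (α : Fin n → ℂˣ) (q : Fin n → ℤ) :
    torusChar α (Multiplicative.ofAdd q) = ((∏ i, α i ^ q i : ℂˣ) : ℂ) := rfl

/-- The subgroup `α₁ ⋯ αₙ = 1` of the torus. -/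
def unitTorus (n : ℕ) : Subgroup (Fin n → ℂˣ) where
  carrier := {α | ∏ i, α i = 1}
  one_mem' := by simp
  mul_mem' := fun {a b} ha hb => by
    simp only [Set.mem_ofPred_eq] at ha hb ⊢
    simp [Finset.prod_mul_distrib, ha, hb]
  inv_mem' := fun {a} ha => by
    simp only [Set.mem_ofPred_eq] at ha ⊢
    simp [ha]

lemma mem_unitTorus {α : Fin n → ℂˣ} : α ∈ unitTorus n ↔ ∏ i, α i = 1 := Iff.rfl

lemma torusChar_ones {α : Fin n → ℂˣ} (hα : α ∈ unitTorus n) :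
    torusChar α (Multiplicative.ofAdd fun _ => 1) = 1 := by
  simp only [torusChar_ofAdd, zpow_one, mem_unitTorus.1 hα, Units.val_one]

/-- A Laurent monomial that is constant on `α₁ ⋯ αₙ = 1` is a power of `α₁ ⋯ αₙ`. -/
lemma eq_of_torusChar_eq_one {q : Fin n → ℤ}
    (h : ∀ α ∈ unitTorus n, torusChar α (Multiplicative.ofAdd q) = 1) (i j : Fin n) :
    q i = q j := by
  by_contra hne
  have hij : i ≠ j := fun h => hne (h ▸ rfl)
  let t : ℂˣ := Units.mk0 2 two_ne_zero
  -- The test point with `2` in place `i` and `1/2` in place `j` turns the hypothesis into `2 ^ (q i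
  -- - q j) = 1`.
  have hmem : Pi.mulSingle i t * Pi.mulSingle j t⁻¹ ∈ unitTorus n := by
    simp [mem_unitTorus, Finset.prod_mul_distrib]
  have h1 := h _ hmem
  rw [torusChar_ofAdd, Units.val_eq_one] at h1
  have h2 : ∀ (k : Fin n) (s : ℂˣ), ∏ x, (Pi.mulSingle k s : Fin n → ℂˣ) x ^ q x = s ^ q k := by
    intro k s
    rw [Finset.prod_eq_single k]
    · simp
    · intro b _ hb
      simp [Pi.mulSingle_eq_of_ne hb]
    · simp
  simp only [Pi.mul_apply, mul_zpow, Finset.prod_mul_distrib, h2, inv_zpow', ← zpow_add] at h1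
  have h3 : (2 : ℝ) ^ (q i + -q j) = 1 := by
    have := congrArg (fun z : ℂˣ => ‖(z : ℂ)‖) h1
    simpa [t] using this
  rw [zpow_eq_one_iff_right₀ (by norm_num) (by norm_num)] at h3
  omega

/-! ### Reversibility as a system of equations -/

/-- The exponents of the monomials of the vector field. -/
def fieldExpo (p : Fin ℓ → Fin n → ℤ) (kj : Param n ℓ) : Fin n → ℕ :=
  fun i => (expo p kj i + if i = kj.2 then 1 else 0).toNat

/-- The hypotheses on the exponents: all entries are nonnegative, except that the first one may
be `-1`. -/
def IsAdmissible (p : Fin ℓ → Fin n → ℤ) : Prop :=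
  ∀ k i, 0 ≤ p k i + if (i : ℕ) = 0 then 1 else 0

/-- `toNat` truncates nothing: `T_n^j` carries the entry that may be `-1` to position `j`, where the
factor `x_j` adds one. -/
lemma IsAdmissible.natCast_fieldExpo [NeZero n] {p : Fin ℓ → Fin n → ℤ} (hp : IsAdmissible p)
    (kj : Param n ℓ) (i : Fin n) :
    (fieldExpo p kj i : ℤ) = expo p kj i + if i = kj.2 then 1 else 0 := by
  refine Int.toNat_of_nonneg ?_
  have h := hp kj.1 (i - kj.2)
  simp only [Fin.val_eq_zero_iff, sub_eq_zero] at h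
  rwa [expo_apply]

lemma fieldExpo_finRotate [NeZero n] (p : Fin ℓ → Fin n → ℤ) (k : Fin ℓ) (j i : Fin n) :
    fieldExpo p (k, finRotate n j) (finRotate n i) = fieldExpo p (k, j) i := by
  simp only [fieldExpo, expo_finRotate, EmbeddingLike.apply_eq_iff_eq]

lemma IsAdmissible.fieldExpo_injective [NeZero n] {p : Fin ℓ → Fin n → ℤ} (hp : IsAdmissible p)
    (hinj : Function.Injective p) (j : Fin n) :
    Function.Injective fun k => fieldExpo p (k, j) := by
  intro k k' h
  refine hinj (funext fun i => ?_)
  have h1 := congrArg (Nat.cast : ℕ → ℤ) (congrFun h (i + j))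
  simp only [hp.natCast_fieldExpo, expo_apply, add_sub_cancel_right] at h1
  exact add_right_cancel h1

lemma cycMatrix_mulVec (α : Fin n → ℂ) (x : Fin n → ℂ) (i : Fin n) :
    (cycMatrix α).mulVec x i = α i * x (finRotate n i) := by
  simp [cycMatrix, Matrix.mulVec, dotProduct]

lemma IsAdmissible.prod_pow_fieldExpo [NeZero n] {p : Fin ℓ → Fin n → ℤ} (hp : IsAdmissible p)
    (α : Fin n → ℂˣ) (k : Fin ℓ) (j : Fin n) :
    ∏ i, (α i : ℂ) ^ fieldExpo p (k, j) i =
      α j * torusChar α (Multiplicative.ofAdd (expo p (k, j))) := by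
  have h : ∏ i, α i ^ fieldExpo p (k, j) i = α j * ∏ i, α i ^ expo p (k, j) i := by
    simp_rw [← zpow_natCast, hp.natCast_fieldExpo, zpow_add, Finset.prod_mul_distrib]
    rw [mul_comm]
    congr 1
    rw [Finset.prod_eq_single j]
    · simp
    · intro b _ hb
      simp [hb]
    · simp
  rw [torusChar_ofAdd, ← Units.val_mul, ← h]
  simp

lemma prod_cycMatrix_mulVec_pow [NeZero n] (p : Fin ℓ → Fin n → ℤ) (α x : Fin n → ℂ)
    (k : Fin ℓ) (j : Fin n) :
    ∏ i, (cycMatrix α).mulVec x i ^ fieldExpo p (k, j) i =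
      (∏ i, α i ^ fieldExpo p (k, j) i) * ∏ i, x i ^ fieldExpo p (k, finRotate n j) i := by
  simp only [cycMatrix_mulVec, mul_pow, Finset.prod_mul_distrib]
  congr 1
  rw [← Equiv.prod_comp (finRotate n) fun i => x i ^ fieldExpo p (k, finRotate n j) i]
  simp only [fieldExpo_finRotate]

lemma pow_finRotate [NeZero n] {ζ : ℂ} (hζ : ζ ^ n = 1) (j : Fin n) :
    ζ ^ (finRotate n j : ℕ) = ζ * ζ ^ (j : ℕ) := by
  rcases finRotate_cases j with h | ⟨hj, h⟩
  · rw [h, pow_succ']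
  · rw [h, ← pow_succ', hj, hζ, pow_zero]

/-- The linear terms cancel because `ζ ^ n = 1`, and substituting `A x` shifts the exponents of
equation `j` to those of equation `j + 1`. What remains has the defects of the twisted relations as
coefficients. -/
lemma IsAdmissible.reversibility_defect [NeZero n] {p : Fin ℓ → Fin n → ℤ} (hp : IsAdmissible p)
    {ζ : ℂ} (hζ : ζ ^ n = 1) (a : Param n ℓ → ℂ) (α : Fin n → ℂˣ) (x : Fin n → ℂ) (j : Fin n) :
    (cycMatrix fun i => (α i : ℂ)).mulVec (vectorField p ζ a x) j -
        (ζ • vectorField p ζ a ((cycMatrix fun i => (α i : ℂ)).mulVec x)) j =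
      α j * ∑ k, (a (k, finRotate n j) -
          ζ * a (k, j) * torusChar α (Multiplicative.ofAdd (expo p (k, j)))) *
        ∏ i, x i ^ fieldExpo p (k, finRotate n j) i := by
  have h (y : Fin n → ℂ) (i : Fin n) : vectorField p ζ a y i = ζ ^ (i : ℕ) * y i +
      ∑ k, a (k, i) * ∏ t, y t ^ fieldExpo p (k, i) t := rfl
  rw [cycMatrix_mulVec, Pi.smul_apply, h, h]
  simp only [prod_cycMatrix_mulVec_pow, hp.prod_pow_fieldExpo]
  simp only [pow_finRotate hζ, cycMatrix_mulVec, smul_eq_mul, sub_mul, Finset.sum_sub_distrib, mul_add, mul_sub,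
    Finset.mul_sum]
  have h1 : ∀ k, ζ * (a (k, j) * (α j * torusChar α (Multiplicative.ofAdd (expo p (k, j))) *
        ∏ i, x i ^ fieldExpo p (k, finRotate n j) i)) =
      α j * (ζ * a (k, j) * torusChar α (Multiplicative.ofAdd (expo p (k, j))) *
        ∏ i, x i ^ fieldExpo p (k, finRotate n j) i) := fun k => by ring
  simp only [h1]
  ring

/-- Distinct monomial functions on `ℂⁿ` are linearly independent. -/
lemma eq_zero_of_sum_mul_prod_pow_eq_zero {ι σ : Type*} [Fintype ι] [Fintype σ]
    {m : ι → σ → ℕ} (hm : Function.Injective m) {c : ι → ℂ}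
    (h : ∀ x : σ → ℂ, ∑ k, c k * ∏ i, x i ^ m k i = 0) (k : ι) : c k = 0 := by
  classical
  let f : MvPolynomial σ ℂ := ∑ k, monomial (Finsupp.equivFunOnFinite.symm (m k)) (c k)
  have hf : f = 0 := by
    refine MvPolynomial.funext fun x => ?_
    simp only [f, map_sum, eval_monomial, map_zero]
    rw [← h x]
    refine Finset.sum_congr rfl fun k _ => ?_
    rw [Finsupp.prod_fintype _ _ fun _ => pow_zero _]
    rfl
  have h1 := congrArg (coeff (Finsupp.equivFunOnFinite.symm (m k))) hf
  simpa [f, coeff_sum, coeff_monomial, hm.eq_iff] using h1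

lemma IsAdmissible.isZetaReversible_iff [NeZero n] {p : Fin ℓ → Fin n → ℤ} (hp : IsAdmissible p)
    (hinj : Function.Injective p) {ζ : ℂ} (hζ : ζ ^ n = 1) {a : Param n ℓ → ℂ} :
    IsZetaReversible p ζ a ↔ ∃ α ∈ unitTorus n, IsTwisted p ζ (torusChar α) a := by
  constructor
  · rintro ⟨β, hβ, h⟩
    have hne : ∀ i, β i ≠ 0 := fun i hi => by
      rw [Finset.prod_eq_zero (Finset.mem_univ i) hi] at hβ
      exact zero_ne_one hβ
    refine ⟨fun i => Units.mk0 (β i) (hne i), ?_, ?_⟩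
    · rw [mem_unitTorus, ← Units.val_eq_one]
      simpa using hβ
    · rintro ⟨k, j⟩
      have h1 := eq_zero_of_sum_mul_prod_pow_eq_zero (hp.fieldExpo_injective hinj (finRotate n j))
        (fun x => by
          have h2 := hp.reversibility_defect hζ a (fun i => Units.mk0 (β i) (hne i)) x j
          rw [show (fun i => ((Units.mk0 (β i) (hne i) : ℂˣ) : ℂ)) = β from rfl, h x, sub_self] at h2
          exact (mul_eq_zero.1 h2.symm).resolve_left (Units.ne_zero _)) k
      exact sub_eq_zero.1 h1
  · rintro ⟨α, hα, h⟩
    refine ⟨fun i => α i, ?_, fun x => funext fun j => sub_eq_zero.1 ?_⟩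
    · simpa using congrArg Units.val (mem_unitTorus.1 hα)
    · rw [hp.reversibility_defect hζ]
      refine mul_eq_zero_of_right _ (Finset.sum_eq_zero fun k _ => ?_)
      have h1 : a (k, finRotate n j) =
        ζ * a (k, j) * torusChar α (Multiplicative.ofAdd (expo p (k, j))) := h (k, j)
      rw [h1, sub_self, zero_mul]

/-! ### Ideals and twisted points -/

/-- Evaluation at `a` extends to the Laurent ring by `α^q ↦ χ(q)` and kills the generators. -/
lemma IsTwisted.aeval_eq_zero_of_mem_elimIdeal {p : Fin ℓ → Fin n → ℤ} {ζ : ℂ}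
    {χ : Multiplicative (Fin n → ℤ) →* ℂ} {a : Param n ℓ → ℂ} (h : IsTwisted p ζ χ a)
    (hχ : χ (Multiplicative.ofAdd fun _ => 1) = 1) {f : ParamRing n ℓ}
    (hf : f ∈ elimIdeal p ζ) : aeval a f = 0 := by
  let Φ : LaurentRing n ℓ →+* ℂ :=
    AddMonoidAlgebra.liftNCRingHom (aeval a : ParamRing n ℓ →ₐ[ℂ] ℂ).toRingHom χ
      fun _ _ => Commute.all _ _
  have hΦα : ∀ q, Φ (alphaPow ℓ q) = χ (Multiplicative.ofAdd q) := fun q => by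
    simp [Φ, alphaPow]
  have hΦi : ∀ g, Φ (inclusion n ℓ g) = aeval a g := fun g => by
    simp [Φ, inclusion]
  have hle : reversibilityIdeal p ζ ≤ RingHom.ker Φ := by
    refine Ideal.span_le.2 ?_
    rintro _ (rfl | ⟨kj, rfl⟩)
    · simp [hΦα, hχ]
    · simp only [SetLike.mem_coe, RingHom.mem_ker, map_sub, map_mul, hΦα, hΦi, aeval_C, aeval_X, h kj,
        sub_self]
  have h1 : Φ (inclusion n ℓ f) = 0 := hle hf
  rwa [hΦi] at h1

lemma IsTwisted.aeval_eq_zero_of_mem_sibirskyR {p : Fin ℓ → Fin n → ℤ} {ζ : ℂ}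
    {χ : Multiplicative (Fin n → ℤ) →* ℂ} {a : Param n ℓ → ℂ} (h : IsTwisted p ζ χ a)
    (hχ : χ (Multiplicative.ofAdd fun _ => 1) = 1) {f : ParamRing n ℓ}
    (hf : f ∈ sibirskyR p ζ) : aeval a f = 0 := by
  have hle : sibirskyR p ζ ≤ RingHom.ker (aeval a : ParamRing n ℓ →ₐ[ℂ] ℂ) := by
    refine Ideal.span_le.2 ?_
    rintro _ ⟨ν, ⟨K, hK⟩, rfl⟩
    have h1 : L p ν = K • fun _ => 1 := funext fun i => by simp [hK i]
    rw [SetLike.mem_coe, RingHom.mem_ker, map_sub, map_mul, aeval_C, h.aeval_mono_hat, h1,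
      ofAdd_nsmul, map_pow χ, hχ, one_pow, mul_one, sub_self]
  exact hle hf

/-- A character of `ℤⁿ` that is trivial on `(1, …, 1)` agrees on vectors with constant
difference. -/
lemma map_ofAdd_eq_of_sub_eq {M : Type*} [Monoid M] {χ : Multiplicative (Fin n → ℤ) →* M}
    (hχ : χ (Multiplicative.ofAdd fun _ => 1) = 1) {q r : Fin n → ℤ}
    (hc : ∃ c : ℤ, ∀ i, q i - r i = c) :
    χ (Multiplicative.ofAdd q) = χ (Multiplicative.ofAdd r) := by
  obtain ⟨c, hc⟩ := hc
  have hz : ∀ m : ℕ, χ (Multiplicative.ofAdd (m • fun _ => 1)) = 1 := fun m => by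
    rw [ofAdd_nsmul, map_pow, hχ, one_pow]
  -- The target has no inverses, so the positive or negative part of `c` is added to the appropriate
  -- side.
  have h1 : q + (-c).toNat • (fun _ => 1) = r + c.toNat • fun _ => 1 := by
    funext i
    have := hc i
    simp only [Pi.add_apply, Pi.smul_apply, Int.nsmul_eq_mul, mul_one]
    omega
  have h2 := congrArg (fun q => χ (Multiplicative.ofAdd q)) h1
  simpa only [ofAdd_add, map_mul, hz, mul_one] using h2

/-- `[u]` and `[v]` are proportional modulo the elimination ideal if they have the same block sums
and the exponents of their characters have a constant difference. -/
lemma binomial_mem_elimIdeal [NeZero n] {p : Fin ℓ → Fin n → ℤ} {ζ : ℂ}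
    {u v : Param n ℓ → ℕ} (hb : blockSum u = blockSum v)
    (hc : ∃ c : ℤ, ∀ i, cumExpo p u i - cumExpo p v i = c) :
    C (ζ ^ weight v) * mono u - C (ζ ^ weight u) * mono v ∈ elimIdeal p ζ := by
  -- In `Q` the classes of the parameters are a tautological twisted family, with `χ(q)` the class
  -- of `α^q`.
  let Q := LaurentRing n ℓ ⧸ reversibilityIdeal p ζ
  let π : LaurentRing n ℓ →+* Q := Ideal.Quotient.mk _
  let χ : Multiplicative (Fin n → ℤ) →* Q :=
    (π : LaurentRing n ℓ →* Q).comp (AddMonoidAlgebra.of (ParamRing n ℓ) (Fin n → ℤ))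
  have hχ : ∀ q, χ (Multiplicative.ofAdd q) = π (alphaPow ℓ q) := fun q => rfl
  have hχ1 : χ (Multiplicative.ofAdd fun _ => 1) = 1 := by
    have h : π (1 - alphaPow ℓ (fun _ => 1)) = 0 :=
      Ideal.Quotient.eq_zero_iff_mem.2 (Ideal.subset_span (Or.inl rfl))
    rw [map_sub, map_one, sub_eq_zero] at h
    rw [hχ, ← h]
  let a : Param n ℓ → Q := fun kj => π (inclusion n ℓ (X kj))
  have hC : ∀ z : ℂ, π (inclusion n ℓ (C z)) = algebraMap ℂ Q z := fun z => by
    rw [← Ideal.Quotient.mk_algebraMap ℂ (reversibilityIdeal p ζ) z]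
    simp [π, inclusion, AddMonoidAlgebra.coe_algebraMap]
  have ha : IsTwisted p ζ χ a := by
    intro kj
    have h : π (inclusion n ℓ (C ζ * X kj) * alphaPow ℓ (expo p kj) -
        inclusion n ℓ (X (kj.1, finRotate n kj.2))) = 0 :=
      Ideal.Quotient.eq_zero_iff_mem.2 (Ideal.subset_span (Or.inr ⟨kj, rfl⟩))
    rw [map_sub, map_mul, map_mul, map_mul, hC, sub_eq_zero] at h
    rw [hχ]
    exact h.symm
  have haev : ∀ f, π (inclusion n ℓ f) = aeval a f := fun f => by
    have : (π.comp (inclusion n ℓ)) = (aeval a : ParamRing n ℓ →ₐ[ℂ] Q).toRingHom := by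
      refine MvPolynomial.ringHom_ext (fun z => ?_) fun kj => ?_
      · simp [hC]
      · simp [a]
    exact RingHom.congr_fun this f
  have hcum : χ (Multiplicative.ofAdd (cumExpo p u)) = χ (Multiplicative.ofAdd (cumExpo p v)) :=
    map_ofAdd_eq_of_sub_eq hχ1 hc
  change inclusion n ℓ _ ∈ reversibilityIdeal p ζ
  rw [← Ideal.Quotient.eq_zero_iff_mem]
  change π _ = 0
  rw [haev, map_sub, map_mul, map_mul, ha.aeval_mono_eq, ha.aeval_mono_eq, hcum, hb, aeval_C,
    aeval_C]
  ring

/-! ### Binomials in the saturation -/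

/-- The exponent `ν` with `ν_{k,j} = u_{k,1} + ⋯ + u_{k,j} + v_{k,j+1} + ⋯ + v_{k,n}`. -/
def splice (u v : Param n ℓ → ℕ) : Param n ℓ → ℕ := fun kj =>
  (∑ t ∈ Finset.Iic kj.2, u (kj.1, t)) + ∑ t ∈ Finset.Ioi kj.2, v (kj.1, t)

lemma hat_apply_finRotate (ν : Param n ℓ → ℕ) (k : Fin ℓ) (j : Fin n) :
    hat ν (k, finRotate n j) = ν (k, j) := by
  simp only [hat, cycShift, Equiv.symm_apply_apply]

/-- Passing from `j - 1` to `j`, the splice gains `u_{k,j}` and loses `v_{k,j}`; equal block sums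
give the same difference at the wrap-around. -/
lemma add_splice [NeZero n] {u v : Param n ℓ → ℕ} (hb : blockSum u = blockSum v) :
    v + splice u v = u + hat (splice u v) := by
  funext ⟨k, j'⟩
  obtain ⟨j, rfl⟩ := (finRotate n).surjective j'
  simp only [Pi.add_apply, hat_apply_finRotate, splice]
  rcases finRotate_cases j with h | ⟨hj, h⟩
  · have h1 : Finset.Iic (finRotate n j) = insert (finRotate n j) (Finset.Iic j) := by
      ext t
      simp only [Finset.mem_Iic, Finset.mem_insert, Fin.le_def, Fin.ext_iff]
      omega
    have h2 : Finset.Ioi j = insert (finRotate n j) (Finset.Ioi (finRotate n j)) := by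
      ext t
      simp only [Finset.mem_Ioi, Finset.mem_insert, Fin.lt_def, Fin.ext_iff]
      omega
    rw [h1, h2, Finset.sum_insert, Finset.sum_insert]
    · ring
    · simp
    · simp only [Finset.mem_Iic, Fin.le_def]
      omega
  · have h1 : Finset.Iic (finRotate n j) = {finRotate n j} := by
      ext t
      simp only [Finset.mem_Iic, Finset.mem_singleton, Fin.le_def, Fin.ext_iff]
      omega
    have h2 : Finset.univ = insert (finRotate n j) (Finset.Ioi (finRotate n j)) := by
      ext t
      simp only [Finset.mem_univ, Finset.mem_Ioi, Finset.mem_insert, Fin.lt_def, Fin.ext_iff,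
        true_iff]
      omega
    have h3 : Finset.Iic j = Finset.univ := by
      ext t
      simp only [Finset.mem_univ, Finset.mem_Iic, Fin.le_def, iff_true]
      omega
    have h4 : Finset.Ioi j = ∅ := by
      ext t
      simp only [Finset.mem_Ioi, Fin.lt_def, Finset.notMem_empty, iff_false]
      omega
    have h5 := congrFun hb k
    simp only [blockSum] at h5
    rw [h1, h3, h4, h5, h2, Finset.sum_insert (by simp)]
    simp only [Finset.sum_singleton, Finset.sum_empty]
    ring

lemma mem_invMonoid_of_torusChar [NeZero n] {p : Fin ℓ → Fin n → ℤ}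
    (hp : ∀ k, 0 ≤ ∑ i, p k i) {ν : Param n ℓ → ℕ}
    (h : ∀ α ∈ unitTorus n, torusChar α (Multiplicative.ofAdd (L p ν)) = 1) :
    ν ∈ invMonoid p := by
  have hconst : ∀ i, L p ν i = L p ν 0 := fun i => eq_of_torusChar_eq_one h i 0
  -- The constant entry is nonnegative because `n` times it is a nonnegative combination of the sums
  -- of the `p_k`.
  have hsum : 0 ≤ ∑ i, L p ν i := by
    simp only [L]
    rw [Finset.sum_comm]
    refine Finset.sum_nonneg fun kj _ => ?_
    rw [← Finset.sum_mul, sum_expo]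
    exact mul_nonneg (hp _) (Int.natCast_nonneg _)
  rw [Finset.sum_congr rfl fun i _ => hconst i, Finset.sum_const, Finset.card_univ,
    Fintype.card_fin, nsmul_eq_mul] at hsum
  have hn : (0 : ℤ) < n := by exact_mod_cast Nat.pos_of_ne_zero (NeZero.ne n)
  obtain ⟨K, hK⟩ := Int.eq_ofNat_of_zero_le (nonneg_of_mul_nonneg_right hsum hn)
  exact ⟨K, fun i => (hconst i).trans hK⟩

lemma mono_dvd_paramProd_pow (ν : Param n ℓ → ℕ) :
    mono ν ∣ paramProd n ℓ ^ ∑ kj, ν kj := by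
  rw [paramProd, ← Finset.prod_pow]
  exact Finset.prod_dvd_prod_of_dvd _ _ fun kj _ =>
    pow_dvd_pow _ (Finset.single_le_sum (fun _ _ => Nat.zero_le _) (Finset.mem_univ kj))

lemma mem_saturation_of_mono_mul_mem {I : Ideal (ParamRing n ℓ)} (ν : Param n ℓ → ℕ)
    {f : ParamRing n ℓ} (h : mono ν * f ∈ I) : f ∈ saturation I (paramProd n ℓ) := by
  obtain ⟨g, hg⟩ := mono_dvd_paramProd_pow ν
  refine ⟨∑ kj, ν kj, ?_⟩
  rw [hg, mul_comm (mono ν), mul_assoc]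
  exact I.mul_mem_left _ h

lemma twistedPoint_ne_zero {p : Fin ℓ → Fin n → ℤ} {ζ : ℂ} (hζ : ζ ≠ 0) (α : Fin n → ℂˣ)
    (y : Fin ℓ → ℂˣ) (kj : Param n ℓ) :
    twistedPoint p ζ (torusChar α) (fun k => (y k : ℂ)) kj ≠ 0 :=
  mul_ne_zero (mul_ne_zero (pow_ne_zero _ hζ) (Units.ne_zero _)) (Units.ne_zero _)

lemma aeval_mono_ne_zero {a : Param n ℓ → ℂ} (ha : ∀ kj, a kj ≠ 0) (ν : Param n ℓ → ℕ) :
    aeval a (mono ν) ≠ 0 := by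
  rw [aeval_mono]
  exact Finset.prod_ne_zero_iff.2 fun kj _ => pow_ne_zero _ (ha kj)

/-- With `ν = splice u v` one has `[v][ν] = [u][ν̂]`, so `[ν]` times the binomial is `ζ^w(u) [u]`
times the generator of `ν`, provided `ν ∈ M` and `ζ^w(v) = ζ^w(u) ζ^|ν|`. Both conditions are read
off from values at twisted points. -/
lemma binomial_mem_saturation [NeZero n] {p : Fin ℓ → Fin n → ℤ} (hp : ∀ k, 0 ≤ ∑ i, p k i)
    {ζ : ℂ} (hζ : ζ ^ n = 1) {u v : Param n ℓ → ℕ} (hb : blockSum u = blockSum v)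
    (hc : ∀ α ∈ unitTorus n, torusChar α (Multiplicative.ofAdd (cumExpo p u)) =
      torusChar α (Multiplicative.ofAdd (cumExpo p v))) :
    C (ζ ^ weight v) * mono u - C (ζ ^ weight u) * mono v ∈
      saturation (sibirskyR p ζ) (paramProd n ℓ) := by
  have hζ0 : ζ ≠ 0 := fun h => by simp [h, NeZero.ne n] at hζ
  set ν := splice u v with hν
  set N := ∑ kj, ν kj with hN
  have hadd : mono v * mono ν = mono u * mono (hat ν) := by
    rw [← mono_add, ← mono_add, hν, add_splice hb]
  have key : ∀ α ∈ unitTorus n,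
      ζ ^ weight v = ζ ^ weight u * ζ ^ N * torusChar α (Multiplicative.ofAdd (L p ν)) := by
    intro α hα
    have ha := isTwisted_twistedPoint (R := ℂ) hζ (torusChar_ones hα) hp
      (fun k => ((1 : ℂˣ) : ℂ))
    have hne := twistedPoint_ne_zero (p := p) hζ0 α (fun _ => 1)
    set a := twistedPoint p ζ (torusChar α) (fun k => ((1 : ℂˣ) : ℂ))
    have h1 := congrArg (aeval a) hadd
    have hy : ∏ k, a (k, 0) ^ blockSum v k ≠ 0 :=
      Finset.prod_ne_zero_iff.2 fun k _ => pow_ne_zero _ (hne _)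
    have hχ : torusChar α (Multiplicative.ofAdd (cumExpo p v)) ≠ 0 := Units.ne_zero _
    rw [map_mul, map_mul, ha.aeval_mono_hat, ha.aeval_mono_eq v, ha.aeval_mono_eq u, hb, hc α hα]
      at h1
    refine mul_right_cancel₀ (mul_ne_zero (mul_ne_zero hy hχ) (aeval_mono_ne_zero hne ν)) ?_
    simp only [Algebra.algebraMap_self, RingHom.id_apply] at h1
    linear_combination h1
  -- At `α = 1` the character disappears, leaving the identity between powers of `ζ`; dividing `key`
  -- by it shows that `L(ν)` is trivial on the torus.
  have hw : ζ ^ weight v = ζ ^ weight u * ζ ^ N := by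
    have h1 : torusChar (1 : Fin n → ℂˣ) (Multiplicative.ofAdd (L p ν)) = 1 := by
      simp [torusChar_ofAdd]
    have h2 := key 1 (one_mem _)
    rwa [h1, mul_one] at h2
  have hmem : ν ∈ invMonoid p := by
    refine mem_invMonoid_of_torusChar hp fun α hα => ?_
    have h1 := key α hα
    rw [hw] at h1
    exact (mul_eq_left₀ (mul_ne_zero (pow_ne_zero _ hζ0) (pow_ne_zero _ hζ0))).1 h1.symm
  refine mem_saturation_of_mono_mul_mem ν ?_
  have hgen : C (ζ ^ N) * mono ν - mono (hat ν) ∈ sibirskyR p ζ :=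
    Ideal.subset_span ⟨ν, hmem, rfl⟩
  convert (sibirskyR p ζ).mul_mem_left (C (ζ ^ weight u) * mono u) hgen using 1
  rw [hw, C_mul]
  linear_combination (-C (ζ ^ weight u)) * hadd

/-! ### The ideal of the dense torus -/

/-- The character of `(y, α)` that gives, up to a constant, the value of `[u]` at the corresponding
twisted point. -/
def monoChar (p : Fin ℓ → Fin n → ℤ) (u : Param n ℓ → ℕ) :
    (Fin ℓ → ℂˣ) × unitTorus n →* ℂ where
  toFun d := (∏ k, (d.1 k : ℂ) ^ blockSum u k) *
    torusChar (d.2 : Fin n → ℂˣ) (Multiplicative.ofAdd (cumExpo p u))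
  map_one' := by simp [torusChar_ofAdd]
  map_mul' d e := by
    simp only [torusChar_ofAdd, Prod.fst_mul, Prod.snd_mul, Pi.mul_apply, Subgroup.coe_mul,
      Units.val_mul, mul_pow, mul_zpow, Finset.prod_mul_distrib]
    ring

lemma monoChar_apply (p : Fin ℓ → Fin n → ℤ) (u : Param n ℓ → ℕ) (y : Fin ℓ → ℂˣ)
    (α : unitTorus n) : monoChar p u (y, α) = (∏ k, (y k : ℂ) ^ blockSum u k) *
      torusChar (α : Fin n → ℂˣ) (Multiplicative.ofAdd (cumExpo p u)) := rfl

lemma blockSum_eq_of_monoChar_eq {p : Fin ℓ → Fin n → ℤ} {u v : Param n ℓ → ℕ}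
    (h : monoChar p u = monoChar p v) : blockSum u = blockSum v := by
  funext k
  let t : ℂˣ := Units.mk0 2 two_ne_zero
  have h1 := DFunLike.congr_fun h (Pi.mulSingle k t, 1)
  have h2 : ∀ w : Fin ℓ → ℕ, ∏ x, ((Pi.mulSingle k t : Fin ℓ → ℂˣ) x : ℂ) ^ w x = 2 ^ w k := by
    intro w
    rw [Finset.prod_eq_single k]
    · simp [t]
    · intro b _ hb
      simp [Pi.mulSingle_eq_of_ne hb]
    · simp
  simp only [monoChar_apply, h2, torusChar_ofAdd, OneMemClass.coe_one, Pi.one_apply, one_zpow,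
    Finset.prod_const_one, Units.val_one, mul_one] at h1
  exact Nat.pow_right_injective le_rfl (by exact_mod_cast h1)

lemma torusChar_eq_of_monoChar_eq {p : Fin ℓ → Fin n → ℤ} {u v : Param n ℓ → ℕ}
    (h : monoChar p u = monoChar p v) (α : Fin n → ℂˣ) (hα : α ∈ unitTorus n) :
    torusChar α (Multiplicative.ofAdd (cumExpo p u)) =
      torusChar α (Multiplicative.ofAdd (cumExpo p v)) := by
  simpa [monoChar_apply] using DFunLike.congr_fun h (1, ⟨α, hα⟩)

lemma exists_cumExpo_sub_eq [NeZero n] {p : Fin ℓ → Fin n → ℤ} {u v : Param n ℓ → ℕ}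
    (h : monoChar p u = monoChar p v) :
    ∃ c : ℤ, ∀ i, cumExpo p u i - cumExpo p v i = c := by
  refine ⟨cumExpo p u 0 - cumExpo p v 0, fun i =>
    eq_of_torusChar_eq_one (q := cumExpo p u - cumExpo p v) (fun α hα => ?_) i 0⟩
  have h1 := torusChar_eq_of_monoChar_eq h α hα
  have hχ : torusChar α (Multiplicative.ofAdd (cumExpo p v)) ≠ 0 := Units.ne_zero _
  refine mul_right_cancel₀ hχ ?_
  rw [← map_mul, ← ofAdd_add, sub_add_cancel, one_mul, h1]

/-- An ideal that contains all binomials with coinciding characters contains all polynomials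
vanishing at the twisted points. -/
lemma mem_of_forall_twistedPoint [NeZero n] {p : Fin ℓ → Fin n → ℤ} (hp : ∀ k, 0 ≤ ∑ i, p k i)
    {ζ : ℂ} (hζ : ζ ^ n = 1) {J : Ideal (ParamRing n ℓ)}
    (hJ : ∀ u v : Param n ℓ → ℕ, monoChar p u = monoChar p v →
      C (ζ ^ weight v) * mono u - C (ζ ^ weight u) * mono v ∈ J)
    {f : ParamRing n ℓ}
    (hf : ∀ (y : Fin ℓ → ℂˣ), ∀ α ∈ unitTorus n,
      aeval (twistedPoint p ζ (torusChar α) fun k => (y k : ℂ)) f = 0) : f ∈ J := by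
  have hζ0 : ζ ≠ 0 := fun h => by simp [h, NeZero.ne n] at hζ
  refine mem_of_forall_eval_eq_zero J (fun u => monoChar p u) (fun u => ζ ^ weight u)
    (fun u => pow_ne_zero _ hζ0)
    (fun d => twistedPoint p ζ (torusChar d.2) fun k => (d.1 k : ℂ)) ?_ ?_ f ?_
  · rintro ⟨y, α⟩ u
    have ha := isTwisted_twistedPoint (R := ℂ) hζ (torusChar_ones α.2) hp fun k => (y k : ℂ)
    have h := ha.aeval_mono_eq u
    rw [monomial_one_eq_mono]
    simp only [monoChar_apply]
    rw [← mul_assoc]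
    simpa [twistedPoint, partialExpo, aeval_eq_eval] using h
  · intro u v h
    rw [monomial_one_eq_mono, monomial_one_eq_mono]
    exact hJ u v h
  · rintro ⟨y, α⟩
    simpa [aeval_eq_eval] using hf y α α.2

end ZetaReversible

/-! ### The main theorem -/

open ZetaReversible MvPolynomial in
theorem mainTheorem1 {n ℓ : ℕ} (hn : n.Prime) (ζ : ℂ) (hζ : IsPrimitiveRoot ζ n)
    (p : Fin ℓ → Fin n → ℤ) (hinj : Function.Injective p)
    (hfirst : ∀ (k : Fin ℓ) (i : Fin n), (i : ℕ) = 0 → -1 ≤ p k i)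
    (hother : ∀ (k : Fin ℓ) (i : Fin n), (i : ℕ) ≠ 0 → 0 ≤ p k i)
    (hsum : ∀ k, 1 ≤ ∑ i, p k i) :
    ZetaReversible.saturation (ZetaReversible.sibirskyR p ζ) (ZetaReversible.paramProd n ℓ) =
        ZetaReversible.elimIdeal p ζ ∧
      MvPolynomial.zeroLocus ℂ (ZetaReversible.elimIdeal p ζ) =
        ZetaReversible.zariskiClosure
          {a : ZetaReversible.Param n ℓ → ℂ | ZetaReversible.IsZetaReversible p ζ a} := by
  have : NeZero n := ⟨hn.ne_zero⟩
  have hζn : ζ ^ n = 1 := hζ.pow_eq_one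
  have hζ0 : ζ ≠ 0 := hζ.ne_zero hn.ne_zero
  have hs : ∀ k, 0 ≤ ∑ i, p k i := fun k => zero_le_one.trans (hsum k)
  have hp : IsAdmissible p := fun k i => by
    split_ifs with h
    · have := hfirst k i h
      omega
    · simpa using hother k i h
  have htw : ∀ (y : Fin ℓ → ℂˣ), ∀ α ∈ unitTorus n,
      IsTwisted p ζ (torusChar α) (twistedPoint p ζ (torusChar α) fun k => (y k : ℂ)) :=
    fun y α hα => isTwisted_twistedPoint hζn (torusChar_ones hα) hs _
  have helim : ∀ f : ParamRing n ℓ, (∀ (y : Fin ℓ → ℂˣ), ∀ α ∈ unitTorus n,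
      aeval (twistedPoint p ζ (torusChar α) fun k => (y k : ℂ)) f = 0) → f ∈ elimIdeal p ζ :=
    fun f => mem_of_forall_twistedPoint hs hζn fun u v h =>
      binomial_mem_elimIdeal (blockSum_eq_of_monoChar_eq h) (exists_cumExpo_sub_eq h)
  refine ⟨le_antisymm ?_ ?_, Set.Subset.antisymm ?_ ?_⟩
  · rintro f ⟨m, hm⟩
    refine helim f fun y α hα => ?_
    have h := (htw y α hα).aeval_eq_zero_of_mem_sibirskyR (torusChar_ones hα) hm
    rw [map_mul, map_pow] at h
    -- All coordinates of these points are nonzero, so the power of `paramProd` cancels.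
    refine (mul_eq_zero.1 h).resolve_left (pow_ne_zero _ ?_)
    simp only [paramProd, map_prod, aeval_X]
    exact Finset.prod_ne_zero_iff.2 fun kj _ => twistedPoint_ne_zero hζ0 α y kj
  · intro f hf
    exact mem_of_forall_twistedPoint hs hζn (fun u v h =>
      binomial_mem_saturation hs hζn (blockSum_eq_of_monoChar_eq h)
        (torusChar_eq_of_monoChar_eq h)) fun y α hα =>
      (htw y α hα).aeval_eq_zero_of_mem_elimIdeal (torusChar_ones hα) hf
  · intro a ha
    refine Set.mem_iInter₂.2 fun J hJ => ?_
    intro f hf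
    -- Any `J` vanishing on the reversible parameters vanishes at the twisted points, hence lies in
    -- `I_ζ`.
    exact ha f (helim f fun y α hα =>
      hJ ((hp.isZetaReversible_iff hinj hζn).2 ⟨α, hα, htw y α hα⟩) f hf)
  · refine Set.iInter₂_subset _ fun a ha f hf => ?_
    obtain ⟨α, hα, h⟩ := (hp.isZetaReversible_iff hinj hζn).1 ha
    exact h.aeval_eq_zero_of_mem_elimIdeal (torusChar_ones hα) hf
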